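/- \textbf{Conventions.} A fuzzy set in a set $\Omega$ is a function $A:\Omega\to[0,1]$ with $A(x_0)=1$ for some $x_0$; for $\alpha\in(0,1]$ its $\alpha$-cut is $A^\alpha=\{x: A(x)\ge\alpha\}$, and its possibility measure is $\Pi_A(B)=\sup_{x\in B}A(x)$ for all $B\subseteq\Omega$, with $\Pi_A(\emptyset)=0$. A fuzzy set in $\mathbb R$ is compact if all its $\alpha$-cuts, $\alpha\in(0,1]$, are compact and nonempty; it is a fuzzy number if moreover all these cuts are convex and there is exactly one point $x_0$ with $A(x_0)=1$; this point is the modal value $\mathbb M A$. Let $\Omega$ carry a possibility measure $\Pi=\Pi_P$ given by a fuzzy set $P$ in $\Omega$. A real fuzzy variable is a function $X:\Omega\to\mathbb R$; its distribution is $B\mapsto\Pi(X^{-1}(B))$, its membership function is $x\mapsto\Pi(X=x)$, and $X$ is a fuzzy number variable if its membership function is a fuzzy number. A t-norm is a commutative, associative map $T:[0,1]^2\to[0,1]$, non-decreasing in both variables, with neutral element $1$; it extends to finitely many arguments by associativity. It is Archimedean if for all $x,y\in(0,1)$ there is $n$ with $T(\underbrace{x,\dots,x}_{n})<y$. Fuzzy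 variables $(X_i)$ are $T$-independent if for all finitely many distinct indices $i_1,\dots,i_k$ and all sets $B_1,\dots,B_k\subseteq\mathbb R$, $$\Pi\Big(\bigcap_{j}X_{i_j}^{-1}(B_j)\Big)=T\big(\Pi(X_{i_1}^{-1}(B_1)),\dots,\Pi(X_{i_k}^{-1}(B_k))\big).$$ Let $Ave(x_1,\dots,x_n)=\frac1n\sum_j x_j$, and let $Med(x_1,\dots,x_n)$ be the median: the middle number in increasing order for odd $n$, and the mean of the two middle numbers for even $n$. \textbf{Theorem (Strong Law of Large Numbers).} Let $T$ be a continuous Archimedean t-norm and $A$ a fuzzy number in $\mathbb R$. Let $(X_n)_{n\ge1}$ be $T$-independent fuzzy variables on $(\Omega,\Pi)$, each with distribution $\Pi_A$, and for $n\ge1$ put $$A_n=Ave(X_1,\dots,X_n),\qquad M_n=Med(X_1,\dots,X_n).$$ Then all $A_n$ and $M_n$ are fuzzy number variables, and for $Y_n=A_n$ as well as for $Y_n=M_n$ the sequence $(Y_n)$ converges to the constant fuzzy variable $c=\mathbb M A$: \begin{enumerate} \item in distribution: for every $\alpha\in(0,1]$ the $\alpha$-cuts of the membership functions of $Y_n$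 converge in the Hausdorff metric to $\{c\}$, the $\alpha$-cut of the membership function of the constant $c$; \item in measure: $\lim_{n\to\infty}\Pi(|Y_n-c|\ge\varepsilon)=0$ for every $\varepsilon>0$; \item almost surely: $\Pi(\{\omega: (Y_n(\omega))_n \text{ does not converge to } c\})=0$. \end{enumerate} -/

import Mathlib

/-- A (normalized) fuzzy set in `Ω`: a membership function `Ω → [0,1]` attaining the value `1`. -/
structure FuzzySet (Ω : Type*) where
  /-- the membership function -/
  mem : Ω → unitInterval
  normalized : ∃ x, mem x = 1

namespace FuzzySet

/-- The `α`-cut `{x | A x ≥ α}`; it is used only for `α ∈ (0,1]`. -/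
def cut {Ω : Type*} (A : FuzzySet Ω) (α : unitInterval) : Set Ω := {x | α ≤ A.mem x}

/-- The possibility measure `Π_A(B) = sup A(B)` of a fuzzy set, defined on all subsets.
The supremum is taken in `[0,1]`, so the empty set has measure `0`. -/
noncomputable def possibility {Ω : Type*} (A : FuzzySet Ω) (B : Set Ω) : unitInterval :=
  sSup (A.mem '' B)

/-- The membership function of the fuzzy variable `X` on the space `Ω` whose possibility measure
is given by the fuzzy set `P`: the fuzzy set `X_* P`, with `X_* P (y) = sup P(X⁻¹(y))`. -/
noncomputable def map {Ω E : Type*} (X : Ω → E) (P : FuzzySet Ω) : FuzzySet E where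
  mem y := P.possibility (X ⁻¹' {y})
  normalized := by
    obtain ⟨x, hx⟩ := P.normalized
    exact ⟨X x, le_antisymm unitInterval.le_one' (le_sSup ⟨x, rfl, hx⟩)⟩

/-- The distribution of the fuzzy variable `X`: the possibility measure `B ↦ Π(X⁻¹(B))`. -/
noncomputable def distribution {Ω E : Type*} (P : FuzzySet Ω) (X : Ω → E) (B : Set E) :
    unitInterval :=
  P.possibility (X ⁻¹' B)

/-- Compact fuzzy sets: all `α`-cuts with `α ∈ (0,1]` are compact and nonempty. -/
def IsCompactFuzzySet {E : Type*} [TopologicalSpace E] (A : FuzzySet E) : Prop :=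
  ∀ α : unitInterval, 0 < α → IsCompact (A.cut α) ∧ (A.cut α).Nonempty

/-- Fuzzy intervals on `ℝ`: compact fuzzy sets with convex `α`-cuts. -/
def IsFuzzyInterval (A : FuzzySet ℝ) : Prop :=
  A.IsCompactFuzzySet ∧ ∀ α : unitInterval, 0 < α → Convex ℝ (A.cut α)

/-- Fuzzy numbers on `ℝ`: fuzzy intervals with exactly one point of membership `1`. -/
def IsFuzzyNumber (A : FuzzySet ℝ) : Prop :=
  A.IsFuzzyInterval ∧ ∃! x, A.mem x = 1

/-- The fuzzy modal set `𝕄 A = A¹`. -/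
def modal {Ω : Type*} (A : FuzzySet Ω) : Set Ω := A.cut 1

/-- For a fuzzy number, `𝕄 A` is a one-point set and is treated as a point. -/
noncomputable def IsFuzzyNumber.modalValue {A : FuzzySet ℝ} (hA : A.IsFuzzyNumber) : ℝ :=
  hA.2.choose

theorem IsFuzzyNumber.modal_eq {A : FuzzySet ℝ} (hA : A.IsFuzzyNumber) :
    A.modal = {hA.modalValue} := by
  ext x
  constructor
  · intro hx
    exact hA.2.choose_spec.2 x (le_antisymm unitInterval.le_one' hx)
  · rintro rfl
    exact hA.2.choose_spec.1.ge

end FuzzySet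

/-- `t`-norms on `[0,1]`. -/
structure IsTNorm (T : unitInterval → unitInterval → unitInterval) : Prop where
  comm : ∀ x y, T x y = T y x
  assoc : ∀ x y z, T (T x y) z = T x (T y z)
  mono : ∀ x x' y y', x ≤ x' → y ≤ y' → T x y ≤ T x' y'
  one_left : ∀ x, T 1 x = x

/-- The extension `T(x₁, …, xₙ)` of a `t`-norm to finitely many arguments; the value for the
empty list is the neutral element `1`. -/
def tnormList (T : unitInterval → unitInterval → unitInterval) (l : List unitInterval) :
    unitInterval :=
  l.foldr T 1

/-- Archimedean: for all `x, y ∈ (0,1)` some power `T(x, …, x)` is less than `y`. -/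
def IsArchimedeanTNorm (T : unitInterval → unitInterval → unitInterval) : Prop :=
  ∀ x y : unitInterval, 0 < x → x < 1 → 0 < y → y < 1 →
    ∃ n : ℕ, tnormList T (List.replicate n x) < y

/-- `T`-independence of a family of fuzzy variables: for every finite subfamily, listed without
repetition as `X_{i₁}, …, X_{iₖ}`, and all sets `B_i`,
`Π(⋂ⱼ X_{iⱼ}⁻¹(B_{iⱼ})) = T(Π(X_{i₁}⁻¹(B_{i₁})), …, Π(X_{iₖ}⁻¹(B_{iₖ})))`. -/
def TIndependent {Ω E ι : Type*} (T : unitInterval → unitInterval → unitInterval)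
    (P : FuzzySet Ω) (X : ι → Ω → E) : Prop :=
  ∀ (l : List ι), l.Nodup → ∀ B : ι → Set E,
    P.possibility (⋂ i ∈ l, X i ⁻¹' B i) =
      tnormList T (l.map fun i => P.possibility (X i ⁻¹' B i))

/-- Levelwise convergence of compact fuzzy sets: for each `α ∈ (0,1]` the `α`-cuts converge in the
Hausdorff metric. -/
def LevelwiseTendsto {E : Type*} [MetricSpace E] (A : ℕ → FuzzySet E) (L : FuzzySet E) : Prop :=
  (∀ n, (A n).IsCompactFuzzySet) ∧ L.IsCompactFuzzySet ∧
    ∀ α : unitInterval, 0 < α →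
      Filter.Tendsto (fun n => Metric.hausdorffDist ((A n).cut α) (L.cut α)) Filter.atTop (nhds 0)

/-- Convergence in distribution: levelwise convergence of the membership functions. -/
def TendstoInFuzzyDistribution {Ω E : Type*} [MetricSpace E] (P : FuzzySet Ω)
    (X : ℕ → Ω → E) (Y : Ω → E) : Prop :=
  LevelwiseTendsto (fun n => P.map (X n)) (P.map Y)

/-- Convergence in (possibility) measure. -/
def TendstoInPossibility {Ω E : Type*} [MetricSpace E] (P : FuzzySet Ω)
    (X : ℕ → Ω → E) (Y : Ω → E) : Prop :=
  ∀ ε : ℝ, 0 < ε →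
    Filter.Tendsto (fun n => P.possibility {ω | ε ≤ dist (X n ω) (Y ω)}) Filter.atTop (nhds 0)

/-- Almost sure convergence: the set of `ω` where `X n ω` fails to converge to `Y ω` has
possibility `0`. -/
def TendstoAlmostSurely {Ω E : Type*} [MetricSpace E] (P : FuzzySet Ω)
    (X : ℕ → Ω → E) (Y : Ω → E) : Prop :=
  P.possibility {ω | ¬ Filter.Tendsto (fun n => X n ω) Filter.atTop (nhds (Y ω))} = 0

/-- The arithmetic mean of the `n + 1` numbers `x 0, …, x n`. -/
noncomputable def fuzzyAve {n : ℕ} (x : Fin (n + 1) → ℝ) : ℝ := (∑ i, x i) / ((n : ℝ) + 1)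

/-- The median of the `n + 1` numbers `x 0, …, x n`: the mean of the entries with indices
`⌊n/2⌋` and `⌊(n+1)/2⌋` in increasing order (counted from `0`). For an odd number of entries both
are the middle entry. -/
noncomputable def fuzzyMed {n : ℕ} (x : Fin (n + 1) → ℝ) : ℝ :=
  (x (Tuple.sort x ⟨n / 2, by omega⟩) + x (Tuple.sort x ⟨(n + 1) / 2, by omega⟩)) / 2

/-! Everything rests on a uniform estimate on level sets. By independence, `P.mem ω` is at most `T`
of the memberships `A.mem (X i ω)` (`mem_le_jointMem`). If this value stays above `α > 0`, the
Archimedean property bounds the number of arguments `≤ β < 1` by some `N` independent of the sample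
size (`exists_card_le`). All other entries lie near the modal value once `β` is close to 1, and the
outliers stay in the compact `α`-cut. Boundedly many bounded outliers move neither mean nor median
in the limit (`IsRobustAt`), and each mode of convergence follows.

The statistics are fuzzy numbers because their cuts are continuous images of compact star-shaped
sets (`cut_map_eq_image`). -/

open Filter Topology Finset

/-! ### Archimedean t-norms -/

section TNorm

variable {T : unitInterval → unitInterval → unitInterval}

theorem IsTNorm.le_right (hT : IsTNorm T) (x y : unitInterval) : T x y ≤ y :=
  (hT.mono x 1 y y unitInterval.le_one' le_rfl).trans_eq (hT.one_left y)

theorem IsTNorm.one_right (hT : IsTNorm T) (x : unitInterval) : T x 1 = x :=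
  (hT.comm x 1).trans (hT.one_left x)

theorem IsTNorm.le_left (hT : IsTNorm T) (x y : unitInterval) : T x y ≤ x :=
  (hT.comm x y).trans_le (hT.le_right y x)

theorem IsTNorm.tnormList_map_mono {ι : Type*} (hT : IsTNorm T) (l : List ι)
    {a b : ι → unitInterval} (hab : ∀ i, a i ≤ b i) :
    tnormList T (l.map a) ≤ tnormList T (l.map b) := by
  induction l with
  | nil => exact le_rfl
  | cons i l ih => exact hT.mono _ _ _ _ (hab i) ih

theorem IsTNorm.tnormList_le_of_mem (hT : IsTNorm T) {l : List unitInterval} {a : unitInterval}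
    (ha : a ∈ l) : tnormList T l ≤ a := by
  induction l with
  | nil => simp at ha
  | cons b l ih =>
    rcases List.mem_cons.1 ha with rfl | h
    · exact hT.le_left _ _
    · exact (hT.le_right _ _).trans (ih h)

theorem IsTNorm.tnormList_map_eq_one {ι : Type*} (hT : IsTNorm T) (l : List ι)
    {a : ι → unitInterval} (ha : ∀ i, a i = 1) : tnormList T (l.map a) = 1 := by
  induction l with
  | nil => rfl
  | cons i l ih =>
    change T (a i) (tnormList T (l.map a)) = 1
    rw [ih, ha, hT.one_left]

theorem continuous_tnormList_map {ι : Type*}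
    (hTcont : Continuous (fun p : unitInterval × unitInterval => T p.1 p.2)) (l : List ι) :
    Continuous (fun a : ι → unitInterval => tnormList T (l.map a)) := by
  induction l with
  | nil => exact continuous_const
  | cons i l ih => exact hTcont.comp ((continuous_apply i).prodMk ih)

theorem IsTNorm.tnormList_le_replicate_countP (hT : IsTNorm T) (β : unitInterval)
    (l : List unitInterval) :
    tnormList T l ≤ tnormList T (List.replicate (l.countP (· ≤ β)) β) := by
  induction l with
  | nil => exact le_rfl
  | cons a l ih =>
    by_cases h : a ≤ β
    · rw [List.countP_cons_of_pos (by simpa using h), List.replicate_succ]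
      exact hT.mono _ _ _ _ h ih
    · rw [List.countP_cons_of_neg (by simpa using h)]
      exact (hT.le_right _ _).trans ih

theorem IsTNorm.antitone_tnormList_replicate (hT : IsTNorm T) (β : unitInterval) :
    Antitone fun n => tnormList T (List.replicate n β) :=
  antitone_nat_of_succ_le fun _ => hT.le_right _ _

theorem IsArchimedeanTNorm.exists_replicate_lt (hTarch : IsArchimedeanTNorm T) (hT : IsTNorm T)
    {α β : unitInterval} (hα : 0 < α) (hβ : β < 1) :
    ∃ N, tnormList T (List.replicate N β) < α := by
  -- This case covers `α = 1`, which the Archimedean property excludes.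
  by_cases h : β < α
  · exact ⟨1, (hT.one_right β).trans_lt h⟩
  · have h := not_lt.1 h
    exact hTarch β α (hα.trans_le h) hβ hα (h.trans_lt hβ)

/-- On a level set of a continuous Archimedean `t`-norm, the number of arguments that stay away
from `1` is bounded independently of the number of arguments. -/
theorem IsArchimedeanTNorm.exists_card_le (hTarch : IsArchimedeanTNorm T) (hT : IsTNorm T)
    {α β : unitInterval} (hα : 0 < α) (hβ : β < 1) :
    ∃ N : ℕ, ∀ (m : ℕ) (a : Fin m → unitInterval),
      α ≤ tnormList T ((List.finRange m).map a) → #{i | a i ≤ β} ≤ N := by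
  obtain ⟨N, hN⟩ := hTarch.exists_replicate_lt hT hα hβ
  refine ⟨N, fun m a ha => ?_⟩
  by_contra! h
  have hcard : ((List.finRange m).map a).countP (· ≤ β) = #{i | a i ≤ β} := by
    rw [List.countP_map, List.countP_eq_length_filter,
      ← List.toFinset_card_of_nodup ((List.nodup_finRange m).filter _)]
    congr 1
    ext i
    simp
  have h1 := hT.tnormList_le_replicate_countP β ((List.finRange m).map a)
  rw [hcard] at h1
  exact absurd (ha.trans (h1.trans (hT.antitone_tnormList_replicate β h.le))) (not_le.2 hN)

end TNorm

/-! ### Possibility measures and fuzzy numbers -/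

namespace FuzzySet

theorem possibility_singleton {E : Type*} (A : FuzzySet E) (x : E) :
    A.possibility {x} = A.mem x := by
  simp [possibility]

theorem le_possibility {Ω : Type*} (P : FuzzySet Ω) {B : Set Ω} {ω : Ω} (h : ω ∈ B) :
    P.mem ω ≤ P.possibility B :=
  le_sSup ⟨ω, h, rfl⟩

theorem possibility_mono {Ω : Type*} (P : FuzzySet Ω) {B C : Set Ω} (h : B ⊆ C) :
    P.possibility B ≤ P.possibility C :=
  sSup_le_sSup (Set.image_mono h)

theorem possibility_le_iff {Ω : Type*} (P : FuzzySet Ω) {B : Set Ω} {α : unitInterval} :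
    P.possibility B ≤ α ↔ ∀ ω ∈ B, P.mem ω ≤ α := by
  simp [possibility, sSup_le_iff]

theorem lt_possibility_iff {Ω : Type*} (P : FuzzySet Ω) {B : Set Ω} {α : unitInterval} :
    α < P.possibility B ↔ ∃ ω ∈ B, α < P.mem ω := by
  simp [possibility, lt_sSup_iff]

theorem cut_map_const {Ω E : Type*} (P : FuzzySet Ω) (c : E) {α : unitInterval} (hα : 0 < α) :
    (P.map fun _ : Ω => c).cut α = {c} := by
  ext y
  constructor
  · intro (hy : α ≤ P.possibility _)
    by_contra h
    refine absurd (hy.trans (P.possibility_le_iff.2 fun ω hω => ?_)) (not_le.2 hα)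
    exact absurd hω.symm h
  · rintro rfl
    obtain ⟨ω, hω⟩ := P.normalized
    exact unitInterval.le_one'.trans (hω.symm.le.trans (P.le_possibility rfl))

theorem IsCompactFuzzySet.upperSemicontinuous {A : FuzzySet ℝ} (hA : A.IsCompactFuzzySet) :
    UpperSemicontinuous A.mem := by
  rw [upperSemicontinuous_iff_isClosed_preimage]
  intro α
  rcases eq_or_lt_of_le (unitInterval.nonneg' : 0 ≤ α) with rfl | h
  · convert isClosed_univ
    ext x
    simp
  · exact (hA α h).1.isClosed

namespace IsFuzzyNumber

variable {A : FuzzySet ℝ} (hA : A.IsFuzzyNumber)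

theorem mem_modalValue : A.mem hA.modalValue = 1 := hA.2.choose_spec.1

theorem eq_modalValue {x : ℝ} (hx : A.mem x = 1) : x = hA.modalValue :=
  hA.2.choose_spec.2 x hx

/-- The cuts of a fuzzy number shrink to its modal value. -/
theorem exists_lt_one_forall_dist_lt {δ : ℝ} (hδ : 0 < δ) :
    ∃ β : unitInterval, β < 1 ∧ ∀ x, β < A.mem x → |x - hA.modalValue| < δ := by
  obtain ⟨γ, hγ0, hγ1⟩ := exists_between (zero_lt_one : (0 : unitInterval) < 1)
  have hK : IsCompact (A.cut γ ∩ {x | δ ≤ |x - hA.modalValue|}) :=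
    (hA.1.1 γ hγ0).1.inter_right (isClosed_le continuous_const (by fun_prop))
  rcases Set.eq_empty_or_nonempty (A.cut γ ∩ {x | δ ≤ |x - hA.modalValue|}) with he | hne
  · refine ⟨γ, hγ1, fun x hx => ?_⟩
    by_contra! h
    exact (he ▸ (⟨hx.le, h⟩ : x ∈ A.cut γ ∩ {x | δ ≤ |x - hA.modalValue|}) :
      x ∈ (∅ : Set ℝ)).elim
  -- The maximum of `A.mem` away from the modal value is attained, hence below 1 by uniqueness; it
  -- serves as `β`.
  · obtain ⟨z, hz, hmax⟩ :=
      (hA.1.1.upperSemicontinuous.upperSemicontinuousOn _).exists_isMaxOn hne hK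
    have hz1 : A.mem z < 1 := by
      refine lt_of_le_of_ne unitInterval.le_one' fun h => ?_
      have h2 : δ ≤ |z - hA.modalValue| := hz.2
      rw [hA.eq_modalValue h, sub_self, abs_zero] at h2
      exact absurd hδ (not_lt.2 h2)
    refine ⟨A.mem z, hz1, fun x hx => ?_⟩
    by_contra! h
    exact absurd (hmax ⟨le_trans hz.1 hx.le, h⟩) (not_le.2 hx)

theorem mem_le_mem_segment (x : ℝ) {a b : ℝ} (ha : 0 ≤ a) (hb : 0 ≤ b) (hab : a + b = 1) :
    A.mem x ≤ A.mem (a * hA.modalValue + b * x) := by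
  rcases eq_or_lt_of_le (unitInterval.nonneg' : 0 ≤ A.mem x) with h | h
  · rw [← h]
    exact unitInterval.nonneg'
  · exact hA.1.2 (A.mem x) h (x := hA.modalValue)
      (unitInterval.le_one'.trans_eq hA.mem_modalValue.symm) (y := x) (le_refl (A.mem x)) ha hb hab

end IsFuzzyNumber

/-- The joint membership function of `m` `T`-independent fuzzy variables with membership
function `A`. -/
noncomputable def jointMem (T : unitInterval → unitInterval → unitInterval) (A : FuzzySet ℝ)
    {m : ℕ} (x : Fin m → ℝ) : unitInterval :=
  tnormList T ((List.finRange m).map fun i => A.mem (x i))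

/-! ### Joint membership and cuts of statistics -/

section Joint

variable {T : unitInterval → unitInterval → unitInterval} {A : FuzzySet ℝ} {m : ℕ}

theorem possibility_joint {Ω : Type*} {P : FuzzySet Ω} {X : ℕ → Ω → ℝ}
    (hindep : TIndependent T P X) (hdist : ∀ n, P.distribution (X n) = A.possibility)
    (x : Fin m → ℝ) :
    P.possibility {ω | (fun i : Fin m => X i ω) = x} = jointMem T A x := by
  have h := hindep ((List.finRange m).map Fin.val)
    ((List.nodup_finRange m).map Fin.val_injective)
    -- Singletons for indices below `m`; the whole line for the others.
    (fun k => {y | ∀ h : k < m, y = x ⟨k, h⟩})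
  rw [List.map_map] at h
  convert h using 2
  · ext ω
    simp [funext_iff, Fin.forall_iff]
  · refine congrArg (tnormList T) (List.map_congr_left fun i _ => ?_)
    have := congrFun (hdist i) {x i}
    rw [possibility_singleton] at this
    rw [← this]
    simp [distribution, Set.preimage]

theorem mem_le_jointMem {Ω : Type*} {P : FuzzySet Ω} {X : ℕ → Ω → ℝ}
    (hindep : TIndependent T P X) (hdist : ∀ n, P.distribution (X n) = A.possibility)
    (ω : Ω) : P.mem ω ≤ jointMem T A fun i : Fin m => X i ω :=
  (P.le_possibility (B := {ω' | (fun i : Fin m => X i ω') = fun i : Fin m => X i ω}) rfl).trans_eq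
    (possibility_joint hindep hdist fun i : Fin m => X i ω)

theorem jointMem_le (hT : IsTNorm T) (x : Fin m → ℝ) (i : Fin m) :
    jointMem T A x ≤ A.mem (x i) :=
  hT.tnormList_le_of_mem (List.mem_map.2 ⟨i, List.mem_finRange i, rfl⟩)

theorem jointMem_modalValue (hT : IsTNorm T) (hA : A.IsFuzzyNumber) :
    jointMem T A (fun _ : Fin m => hA.modalValue) = 1 :=
  hT.tnormList_map_eq_one _ fun _ => hA.mem_modalValue

/-- A superlevel set is the projection, along the compact cube of membership values, of a closed
set; monotonicity of `T` lets the hypograph replace the graph of `A.mem`. -/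
theorem upperSemicontinuous_jointMem (hT : IsTNorm T)
    (hTcont : Continuous (fun p : unitInterval × unitInterval => T p.1 p.2))
    (hA : A.IsCompactFuzzySet) :
    UpperSemicontinuous (jointMem T A : (Fin m → ℝ) → unitInterval) := by
  rw [upperSemicontinuous_iff_isClosed_preimage]
  intro α
  have hhyp : IsClosed {p : ℝ × unitInterval | p.2 ≤ A.mem p.1} :=
    hA.upperSemicontinuous.IsClosed_hypograph
  have hS : IsClosed {p : (Fin m → ℝ) × (Fin m → unitInterval) |
      (∀ i, p.2 i ≤ A.mem (p.1 i)) ∧ α ≤ tnormList T ((List.finRange m).map p.2)} := by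
    refine IsClosed.and ?_ (isClosed_le continuous_const
      ((continuous_tnormList_map hTcont _).comp continuous_snd))
    simp only [Set.ofPred_forall]
    exact isClosed_iInter fun i => hhyp.preimage
      (f := fun p : (Fin m → ℝ) × (Fin m → unitInterval) => (p.1 i, p.2 i)) (by fun_prop)
  convert isClosedMap_fst_of_compactSpace _ hS
  ext x
  constructor
  · intro hx
    exact ⟨(x, fun i => A.mem (x i)), ⟨fun _ => le_rfl, hx⟩, rfl⟩
  · rintro ⟨⟨_, a⟩, ⟨ha, hα⟩, rfl⟩
    exact hα.trans (hT.tnormList_map_mono _ ha)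

theorem isCompact_jointMem_cut (hT : IsTNorm T)
    (hTcont : Continuous (fun p : unitInterval × unitInterval => T p.1 p.2))
    (hA : A.IsCompactFuzzySet) {α : unitInterval} (hα : 0 < α) :
    IsCompact {x : Fin m → ℝ | α ≤ jointMem T A x} :=
  (isCompact_univ_pi fun _ => (hA α hα).1).of_isClosed_subset
    ((upperSemicontinuous_jointMem hT hTcont hA).isClosed_preimage α)
    fun _ hx i _ => le_trans hx (jointMem_le hT _ i)

/-- Moving all coordinates towards the modal value lowers no membership. These sets need not be
convex, but connectedness of their images suffices. -/
theorem starConvex_jointMem_cut (hT : IsTNorm T) (hA : A.IsFuzzyNumber) (α : unitInterval) :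
    StarConvex ℝ (fun _ => hA.modalValue) {x : Fin m → ℝ | α ≤ jointMem T A x} :=
  fun x hx _ _ ha hb hab => le_trans (show α ≤ jointMem T A x from hx)
    (hT.tnormList_map_mono _ fun i => hA.mem_le_mem_segment (x i) ha hb hab)

theorem cut_map_eq_image {Ω : Type*} {P : FuzzySet Ω} {X : ℕ → Ω → ℝ} (hT : IsTNorm T)
    (hTcont : Continuous (fun p : unitInterval × unitInterval => T p.1 p.2))
    (hA : A.IsCompactFuzzySet)
    (hindep : TIndependent T P X) (hdist : ∀ n, P.distribution (X n) = A.possibility)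
    {f : (Fin m → ℝ) → ℝ} (hf : Continuous f) {α : unitInterval} (hα : 0 < α) :
    (P.map fun ω => f fun i => X i ω).cut α = f '' {x | α ≤ jointMem T A x} := by
  ext y
  constructor
  · intro (hy : α ≤ P.possibility _)
    -- The supremum over the fibre of `y` must be attained. Cutting the fibre at a level `γ` with `0
    -- < γ < α` makes it compact and keeps it nonempty.
    obtain ⟨γ, hγ0, hγα⟩ := exists_between hα
    have hne : ∀ β < α, ∃ x : Fin m → ℝ, f x = y ∧ β < jointMem T A x := by
      intro β hβ
      obtain ⟨ω, hω, hβω⟩ := P.lt_possibility_iff.1 (hβ.trans_le hy)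
      exact ⟨_, hω, hβω.trans_le (mem_le_jointMem hindep hdist ω)⟩
    have hK : IsCompact ({x : Fin m → ℝ | γ ≤ jointMem T A x} ∩ f ⁻¹' {y}) :=
      (isCompact_jointMem_cut hT hTcont hA hγ0).inter_right (isClosed_singleton.preimage hf)
    obtain ⟨x₀, hx₀, hγx₀⟩ := hne γ hγα
    have hK' : ({x : Fin m → ℝ | γ ≤ jointMem T A x} ∩ f ⁻¹' {y}).Nonempty :=
      ⟨x₀, hγx₀.le, hx₀⟩
    obtain ⟨z, hz, hmax⟩ :=
      ((upperSemicontinuous_jointMem hT hTcont hA).upperSemicontinuousOn _).exists_isMaxOn hK' hK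
    refine ⟨z, ?_, hz.2⟩
    by_contra h
    obtain ⟨x, hx, hlt⟩ := hne _ (not_le.1 h)
    exact absurd (hmax ⟨le_trans hz.1 hlt.le, hx⟩) (not_le.2 hlt)
  · rintro ⟨x, hx, rfl⟩
    refine le_trans (show α ≤ jointMem T A x from hx) ?_
    rw [← possibility_joint hindep hdist x]
    refine P.possibility_mono ?_
    rintro ω rfl
    rfl

theorem isFuzzyNumber_map {Ω : Type*} {P : FuzzySet Ω} {X : ℕ → Ω → ℝ} (hT : IsTNorm T)
    (hTcont : Continuous (fun p : unitInterval × unitInterval => T p.1 p.2))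
    (hA : A.IsFuzzyNumber)
    (hindep : TIndependent T P X) (hdist : ∀ n, P.distribution (X n) = A.possibility)
    {f : (Fin m → ℝ) → ℝ} (hf : Continuous f) :
    (P.map fun ω => f fun i => X i ω).IsFuzzyNumber := by
  have hcut := fun (α : unitInterval) (hα : 0 < α) =>
    cut_map_eq_image hT hTcont hA.1.1 hindep hdist hf hα
  have hmem : ∀ α : unitInterval,
      (fun _ => hA.modalValue) ∈ {x : Fin m → ℝ | α ≤ jointMem T A x} := fun α =>
    unitInterval.le_one'.trans_eq (jointMem_modalValue hT hA).symm
  refine ⟨⟨fun α hα => ?_, fun α hα => ?_⟩, ?_⟩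
  · rw [hcut α hα]
    exact ⟨(isCompact_jointMem_cut hT hTcont hA.1.1 hα).image hf,
      (Set.nonempty_of_mem (hmem α)).image f⟩
  -- On the line, convex means connected.
  · rw [hcut α hα, convex_iff_ordConnected, ← isPreconnected_iff_ordConnected]
    exact (((starConvex_jointMem_cut hT hA α).isPathConnected
      (hmem α)).isConnected.isPreconnected).image _ hf.continuousOn
  · have key : ∀ y, (P.map fun ω => f fun i => X i ω).mem y = 1 ↔
        y = f fun _ => hA.modalValue := by
      intro y
      have h1 : (P.map fun ω => f fun i => X i ω).mem y = 1 ↔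
          y ∈ (P.map fun ω => f fun i => X i ω).cut 1 :=
        ⟨fun h => h.ge, fun h => le_antisymm unitInterval.le_one' h⟩
      rw [h1, hcut 1 zero_lt_one]
      constructor
      · rintro ⟨x, hx, rfl⟩
        congr 1
        funext i
        exact hA.eq_modalValue
          (le_antisymm unitInterval.le_one' (le_trans hx (jointMem_le hT x i)))
      · rintro rfl
        exact Set.mem_image_of_mem f (hmem 1)
    exact ⟨_, (key _).2 rfl, fun y hy => (key y).1 hy⟩

end Joint

/-- A sequence of statistics that is robust at `c`: on uniformly bounded samples with a bounded
number of entries away from `c` it converges uniformly to `c`. -/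
def IsRobustAt (f : ∀ n : ℕ, (Fin (n + 1) → ℝ) → ℝ) (c : ℝ) : Prop :=
  ∀ (R ε : ℝ), 0 < ε → ∃ δ > 0, ∀ N : ℕ, ∃ n₀ : ℕ, ∀ n ≥ n₀, ∀ x : Fin (n + 1) → ℝ,
    (∀ i, |x i - c| ≤ R) → #{i | δ ≤ |x i - c|} ≤ N → |f n x - c| < ε

/-! ### Robustness of mean and median -/

theorem isRobustAt_fuzzyAve (c : ℝ) : IsRobustAt (fun _ => fuzzyAve) c := by
  intro R ε hε
  refine ⟨ε / 2, half_pos hε, fun N => ?_⟩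
  -- Beyond `n₀` the outliers, of total deviation at most `N * |R|`, use less than half of the
  -- allowance `(n + 1) * ε`.
  obtain ⟨n₀, hn₀⟩ := exists_nat_gt (N * |R| / (ε / 2))
  refine ⟨n₀, fun n hn x hR hN => ?_⟩
  have hn1 : (0 : ℝ) < n + 1 := by positivity
  have hpt : ∀ i, |x i - c| ≤ ε / 2 + if ε / 2 ≤ |x i - c| then |R| else 0 := by
    intro i
    split_ifs with h
    · linarith [hR i, le_abs_self R]
    · linarith
  have hsum : ∑ i, |x i - c| ≤ (n + 1) * (ε / 2) + N * |R| := by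
    refine (Finset.sum_le_sum fun i _ => hpt i).trans ?_
    rw [Finset.sum_add_distrib, ← Finset.sum_filter, Finset.sum_const, Finset.sum_const,
      nsmul_eq_mul, nsmul_eq_mul, Finset.card_univ, Fintype.card_fin]
    push_cast
    gcongr
  have hlt : N * |R| < (n + 1) * (ε / 2) := by
    rw [div_lt_iff₀ (half_pos hε)] at hn₀
    refine hn₀.trans_le ?_
    gcongr
    have : (n₀ : ℝ) ≤ n := by exact_mod_cast hn
    linarith
  have heq : fuzzyAve x - c = (∑ i, (x i - c)) / (n + 1) := by
    unfold fuzzyAve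
    rw [Finset.sum_sub_distrib, Finset.sum_const, Finset.card_univ, Fintype.card_fin, nsmul_eq_mul]
    push_cast
    field_simp
  rw [heq, abs_div, abs_of_pos hn1, div_lt_iff₀ hn1]
  linarith [Finset.abs_sum_le_sum_abs (fun i => x i - c) univ]

/-- The `k`-th entry of `x` in increasing order is at most `a` iff more than `k` entries are. -/
theorem sort_apply_le_iff {m : ℕ} (x : Fin m → ℝ) (k : Fin m) (a : ℝ) :
    x (Tuple.sort x k) ≤ a ↔ (k : ℕ) < #{i | x i ≤ a} := by
  have h := Tuple.lt_card_le_iff_apply_le_of_monotone (j := k) (a := a) (Tuple.monotone_sort x)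
  refine h.symm.trans ?_
  have hcard : #{i | (x ∘ Tuple.sort x) i ≤ a} = #{i | x i ≤ a} :=
    Finset.card_bij (fun i _ => Tuple.sort x i) (by simp)
      (fun _ _ _ _ h => (Tuple.sort x).injective h)
      (fun i hi => ⟨(Tuple.sort x).symm i, by simpa using hi, by simp⟩)
  rw [hcard]

/-- By counting entries below a threshold; it makes order statistics 1-Lipschitz although the
sorting permutation jumps. -/
theorem sort_apply_le_add_dist {m : ℕ} (x y : Fin m → ℝ) (k : Fin m) :
    x (Tuple.sort x k) ≤ y (Tuple.sort y k) + dist x y := by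
  rw [sort_apply_le_iff]
  refine ((sort_apply_le_iff y k _).1 le_rfl).trans_le (Finset.card_le_card fun i hi => ?_)
  simp only [Finset.mem_filter_univ] at hi ⊢
  have h1 : x i - y i ≤ dist x y := (le_abs_self _).trans (dist_le_pi_dist x y i)
  linarith

theorem continuous_sort_apply {m : ℕ} (k : Fin m) :
    Continuous fun x : Fin m → ℝ => x (Tuple.sort x k) :=
  (LipschitzWith.of_le_add fun x y => sort_apply_le_add_dist x y k).continuous

/-- An order statistic stays close to `c` if fewer entries are away from `c` than lie before or
after its position. -/
theorem abs_sort_apply_sub_le {m : ℕ} {x : Fin m → ℝ} {c δ : ℝ} {N : ℕ}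
    (hN : #{i | δ ≤ |x i - c|} ≤ N) {k : Fin m} (hk : N ≤ k) (hk' : k + N < m) :
    |x (Tuple.sort x k) - c| ≤ δ := by
  rw [abs_le]
  constructor
  · by_contra! h
    have h1 := (sort_apply_le_iff x k _).1 le_rfl
    have h2 : #{i | x i ≤ x (Tuple.sort x k)} ≤ #{i | δ ≤ |x i - c|} := by
      refine Finset.card_le_card fun i hi => ?_
      simp only [Finset.mem_filter_univ] at hi ⊢
      linarith [neg_abs_le (x i - c)]
    omega
  · rw [sub_le_iff_le_add, sort_apply_le_iff]
    have h1 : #{i | ¬ δ ≤ |x i - c|} ≤ #{i | x i ≤ δ + c} := by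
      refine Finset.card_le_card fun i hi => ?_
      simp only [Finset.mem_filter_univ] at hi ⊢
      linarith [le_abs_self (x i - c)]
    have h2 := Finset.card_filter_add_card_filter_not (s := univ) (fun i => δ ≤ |x i - c|)
    rw [Finset.card_univ, Fintype.card_fin] at h2
    omega

theorem continuous_fuzzyMed {n : ℕ} : Continuous (fuzzyMed : (Fin (n + 1) → ℝ) → ℝ) :=
  ((continuous_sort_apply _).add (continuous_sort_apply _)).div_const 2

theorem continuous_fuzzyAve {n : ℕ} : Continuous (fuzzyAve : (Fin (n + 1) → ℝ) → ℝ) := by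
  unfold fuzzyAve
  fun_prop

theorem isRobustAt_fuzzyMed (c : ℝ) : IsRobustAt (fun _ => fuzzyMed) c := by
  intro R ε hε
  -- This size leaves at least `N` positions on either side of both middle ones.
  refine ⟨ε / 2, half_pos hε, fun N => ⟨2 * N + 2, fun n hn x _ hN => ?_⟩⟩
  have h1 := abs_sort_apply_sub_le hN (k := ⟨n / 2, by omega⟩)
    (by dsimp only; omega) (by dsimp only; omega)
  have h2 := abs_sort_apply_sub_le hN (k := ⟨(n + 1) / 2, by omega⟩)
    (by dsimp only; omega) (by dsimp only; omega)
  rw [abs_le] at h1 h2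
  unfold fuzzyMed
  rw [abs_lt]
  constructor <;> linarith [h1.1, h1.2, h2.1, h2.2]

/-! ### The three modes of convergence -/

section Convergence

variable {T : unitInterval → unitInterval → unitInterval} {A : FuzzySet ℝ}

/-- The order of choices matters: `δ` fixes `β`, and `α` and `β` fix `N`. Hence robustness must
supply `δ` before `N`. -/
theorem IsRobustAt.eventually_of_le_jointMem {f : ∀ n : ℕ, (Fin (n + 1) → ℝ) → ℝ}
    (hA : A.IsFuzzyNumber) (hf : IsRobustAt f hA.modalValue)
    (hT : IsTNorm T) (hTarch : IsArchimedeanTNorm T)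
    {α : unitInterval} (hα : 0 < α) {ε : ℝ} (hε : 0 < ε) :
    ∀ᶠ n in atTop, ∀ x : Fin (n + 1) → ℝ, α ≤ jointMem T A x →
      |f n x - hA.modalValue| < ε := by
  obtain ⟨R, hR⟩ := (hA.1.1 α hα).1.isBounded.subset_closedBall hA.modalValue
  obtain ⟨δ, hδ, hf⟩ : ∃ δ > 0, ∀ N : ℕ, ∃ n₀ : ℕ, ∀ n ≥ n₀, ∀ x : Fin (n + 1) → ℝ,
      (∀ i, |x i - hA.modalValue| ≤ R) → #{i | δ ≤ |x i - hA.modalValue|} ≤ N →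
      |f n x - hA.modalValue| < ε := hf R ε hε
  obtain ⟨β, hβ, hdist⟩ := hA.exists_lt_one_forall_dist_lt hδ
  obtain ⟨N, hN⟩ := hTarch.exists_card_le hT hα hβ
  obtain ⟨n₀, hn₀⟩ := hf N
  filter_upwards [eventually_ge_atTop n₀] with n hn x hx
  refine hn₀ n hn x (fun i => hR (le_trans hx (jointMem_le hT x i))) ?_
  refine le_trans (Finset.card_le_card fun i hi => ?_) (hN _ _ hx)
  simp only [Finset.mem_filter_univ] at hi ⊢
  by_contra! h
  exact absurd (hdist _ h) (not_lt.2 hi)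

theorem strong_law {Ω : Type*} {P : FuzzySet Ω} (hT : IsTNorm T)
    (hTcont : Continuous (fun p : unitInterval × unitInterval => T p.1 p.2))
    (hTarch : IsArchimedeanTNorm T) (hA : A.IsFuzzyNumber)
    {X : ℕ → Ω → ℝ} (hindep : TIndependent T P X)
    (hdist : ∀ n, P.distribution (X n) = A.possibility)
    {f : ∀ n : ℕ, (Fin (n + 1) → ℝ) → ℝ} (hfc : ∀ n, Continuous (f n))
    (hf : IsRobustAt f hA.modalValue) {Y : ℕ → Ω → ℝ}
    (hY : ∀ n ω, Y n ω = f n (fun i : Fin (n + 1) => X i ω)) :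
    (∀ n, (P.map (Y n)).IsFuzzyNumber) ∧
      TendstoInFuzzyDistribution P Y (fun _ => hA.modalValue) ∧
      TendstoInPossibility P Y (fun _ => hA.modalValue) ∧
      TendstoAlmostSurely P Y (fun _ => hA.modalValue) := by
  obtain rfl : Y = fun n ω => f n (fun i : Fin (n + 1) => X i ω) := by
    funext n ω
    exact hY n ω
  have hev := fun {α : unitInterval} (hα : 0 < α) {ε : ℝ} (hε : 0 < ε) =>
    IsRobustAt.eventually_of_le_jointMem hA hf hT hTarch hα hε
  have hfuzzy := fun n => isFuzzyNumber_map hT hTcont hA hindep hdist (hfc n)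
  have hconst : ∀ α : unitInterval, 0 < α →
      (P.map fun _ : Ω => hA.modalValue).cut α = {hA.modalValue} :=
    fun α hα => cut_map_const P _ hα
  refine ⟨hfuzzy, ⟨fun n => (hfuzzy n).1.1, fun α hα => ?_, fun α hα => ?_⟩, fun ε hε => ?_, ?_⟩
  · rw [hconst α hα]
    exact ⟨isCompact_singleton, Set.singleton_nonempty _⟩
  · rw [Metric.tendsto_atTop']
    intro ε hε
    obtain ⟨n₀, hn₀⟩ := eventually_atTop.1 (hev hα (half_pos hε))
    refine ⟨n₀, fun n hn => ?_⟩
    rw [hconst α hα, Real.dist_0_eq_abs, abs_of_nonneg Metric.hausdorffDist_nonneg]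
    have hcut : ∀ y ∈ (P.map fun ω => f n fun i => X i ω).cut α,
        dist y hA.modalValue ≤ ε / 2 := by
      rw [cut_map_eq_image hT hTcont hA.1.1 hindep hdist (hfc n) hα]
      rintro _ ⟨x, hx, rfl⟩
      exact (hn₀ n hn.le x hx).le
    refine (Metric.hausdorffDist_le_of_mem_dist (half_pos hε).le
      (fun y hy => ⟨_, Set.mem_singleton _, hcut y hy⟩) ?_).trans_lt (half_lt_self hε)
    rintro _ rfl
    -- As the limit cut is a point, any element of the nonempty cut does.
    obtain ⟨y, hy⟩ := ((hfuzzy n).1.1 α hα).2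
    exact ⟨y, hy, by rw [dist_comm]; exact hcut y hy⟩
  · refine tendsto_order.2 ⟨fun a ha => absurd ha (not_lt.2 unitInterval.nonneg'), fun a ha => ?_⟩
    obtain ⟨α, hα, hαa⟩ := exists_between ha
    filter_upwards [hev hα hε] with n hn
    refine (P.possibility_le_iff.2 fun ω hω => ?_).trans_lt hαa
    by_contra! h
    exact absurd (hn _ (h.le.trans (mem_le_jointMem hindep hdist ω))) (not_lt.2 hω)
  · refine le_antisymm (P.possibility_le_iff.2 fun ω hω => ?_) unitInterval.nonneg'
    by_contra! h
    refine hω (Metric.tendsto_atTop.2 fun ε hε => ?_)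
    -- The level is `P.mem ω` itself: every `ω` of positive membership gives a convergent sequence.
    obtain ⟨n₀, hn₀⟩ := eventually_atTop.1 (hev h hε)
    exact ⟨n₀, fun n hn => hn₀ n hn _ (mem_le_jointMem hindep hdist ω)⟩

end Convergence

end FuzzySet

theorem mainTheorem3 {Ω : Type*} (P : FuzzySet Ω)
    (T : unitInterval → unitInterval → unitInterval) (hT : IsTNorm T)
    (hTcont : Continuous (fun p : unitInterval × unitInterval => T p.1 p.2))
    (hTarch : IsArchimedeanTNorm T)
    (A : FuzzySet ℝ) (hA : A.IsFuzzyNumber)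
    (X : ℕ → Ω → ℝ) (hindep : TIndependent T P X)
    (hdist : ∀ n, P.distribution (X n) = A.possibility)
    (Aₙ Mₙ : ℕ → Ω → ℝ)
    (hAₙ : ∀ n ω, Aₙ n ω = fuzzyAve (fun i : Fin (n + 1) => X i ω))
    (hMₙ : ∀ n ω, Mₙ n ω = fuzzyMed (fun i : Fin (n + 1) => X i ω)) :
    ((∀ n, (P.map (Aₙ n)).IsFuzzyNumber) ∧
      TendstoInFuzzyDistribution P Aₙ (fun _ => hA.modalValue) ∧
      TendstoInPossibility P Aₙ (fun _ => hA.modalValue) ∧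
      TendstoAlmostSurely P Aₙ (fun _ => hA.modalValue)) ∧
    ((∀ n, (P.map (Mₙ n)).IsFuzzyNumber) ∧
      TendstoInFuzzyDistribution P Mₙ (fun _ => hA.modalValue) ∧
      TendstoInPossibility P Mₙ (fun _ => hA.modalValue) ∧
      TendstoAlmostSurely P Mₙ (fun _ => hA.modalValue)) := by
  exact ⟨FuzzySet.strong_law hT hTcont hTarch hA hindep hdist
      (fun _ => FuzzySet.continuous_fuzzyAve) (FuzzySet.isRobustAt_fuzzyAve _) hAₙ,
    FuzzySet.strong_law hT hTcont hTarch hA hindep hdist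
      (fun _ => FuzzySet.continuous_fuzzyMed) (FuzzySet.isRobustAt_fuzzyMed _) hMₙ⟩
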